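/- **The protocol.** There are $n$ users; user $i$ holds a bin $x_i\in\{1,\dots,d\}$. Fix a flipping probability $q$ and an integer $k\ge 0$ (the number of fake users per user). In the histogram protocol each user prepares $k+1$ strings of $d$ bits, namely the one-hot encoding of $x_i$ and $k$ zero strings, flips every bit of every string independently with probability $q$, and sends the $k+1$ resulting strings as messages. A shuffler permutes all $n(k+1)$ messages by a uniformly random permutation. From the shuffled messages $y$ the analyzer computes, for each bin $j$, the estimate $$z_j=\frac{1}{1-2q}\Big(\frac1n\sum_{y} y_j-(k+1)q\Big)$$ of the frequency $\frac1n|\{i:x_i=j\}|$. The maximum error is $\max_j \big|z_j-\frac1n|\{i:x_i=j\}|\big|$. The protocol is $(\varepsilon,\delta)$-shuffle private if the output $S(x)$ of the shuffler satisfies $\Pr[S(x)\in T]\le e^{\varepsilon}\Pr[S(x')\in T]+\delta$ for every event $T$ and all datasets $x,x'\in\{1,\dots,d\}^n$ that differ in the data of at most one user. **Theorem.** Consider the protocol with $k=0$, in which each user sends a single $d$-bit message, and take (logarithms are natural) $$q=\frac{1}{1+e^{\varepsilon_0/2}},\qquad e^{\varepsilon_0}=\frac{\min(1,\varepsilon)^2\,n}{80\log(4/\delta)}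 .$$ 1. (Privacy.) For all $d$, $n$, $\varepsilon>0$ and $0<\delta<1$ with $n\ge 80\log(4/\delta)/\min(1,\varepsilon)^2$, the protocol is $(\varepsilon,\delta)$-shuffle private. 2. (Accuracy.) For every $E>0$ there is a constant $C>0$, depending only on $E$, such that for all $d\ge 2$, $0<\varepsilon\le E$, $0<\delta\le 1/2$ and $n\ge 320\log(4/\delta)/\min(1,\varepsilon)^2$, and for every dataset, with probability at least $9/10$ the maximum error is at most $$C\left(\frac{\log d}{n}+\frac{\sqrt{\log d}}{\sqrt{\varepsilon}\,n^{3/4}}\Big(\log\frac1\delta\Big)^{1/4}\right).$$ -/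

import Mathlib

noncomputable section

namespace ShuffleHistogram

/-- The product distribution: the coordinates `y i` are drawn independently from `p i`. -/
def piPMF {ι α : Type*} [Fintype ι] [DecidableEq ι] [Fintype α] (p : ι → PMF α) : PMF (ι → α) :=
  PMF.ofFintype (fun y => ∏ i, p i (y i)) (by
    have h := Finset.prod_univ_sum (fun _ : ι => (Finset.univ : Finset α)) (fun i a => p i a)
    rw [Fintype.piFinset_univ] at h
    rw [← h]
    refine Finset.prod_eq_one fun i _ => ?_
    have h1 := (p i).tsum_coe
    rwa [tsum_fintype] at h1)

/-- `M` is `(ε, δ)`-differentially private: for any two datasets of `n` users that differ in the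
data of at most one user, and for every event `T`. -/
def IsDP {X Y : Type*} {n : ℕ} (ε δ : ℝ) (M : (Fin n → X) → PMF Y) : Prop :=
  ∀ x x' : Fin n → X, (∃ i, ∀ j, j ≠ i → x j = x' j) → ∀ T : Set Y,
    (M x).toOuterMeasure T ≤
      ENNReal.ofReal (Real.exp ε) * (M x').toOuterMeasure T + ENNReal.ofReal δ

/-- The shuffler: it permutes the messages it receives by a uniformly random permutation. -/
def shuffle {ι M : Type*} [Fintype ι] [DecidableEq ι] (y : ι → M) : PMF (ι → M) :=
  (PMF.uniformOfFintype (Equiv.Perm ι)).map fun σ => y ∘ σ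

/-- A shuffle protocol for `n` users with data in `X`, in which each user sends `m` messages from
the message space `M` to the shuffler and the analyzer computes an output in `Z` from the shuffled
messages. -/
structure ShuffleProtocol (X M Z : Type*) (n m : ℕ) where
  /-- the local randomizer, run by every user on their own data with independent randomness -/
  randomizer : X → PMF (Fin m → M)
  /-- the analyzer, run on the output of the shuffler -/
  analyzer : (Fin n × Fin m → M) → Z

namespace ShuffleProtocol

variable {X M Z : Type*} {n m : ℕ}

/-- The output of the shuffler, when the `n` users have data `x`. -/
def shuffled [Fintype M] (P : ShuffleProtocol X M Z n m) (x : Fin n → X) :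
    PMF (Fin n × Fin m → M) :=
  (piPMF fun i => P.randomizer (x i)).bind fun y => shuffle fun p => y p.1 p.2

/-- The output of the analyzer, when the `n` users have data `x`. -/
def output [Fintype M] (P : ShuffleProtocol X M Z n m) (x : Fin n → X) : PMF Z :=
  (P.shuffled x).map P.analyzer

/-- `(ε, δ)`-shuffle privacy: the output of the shuffler is `(ε, δ)`-differentially private. -/
def IsShufflePrivate [Fintype M] (P : ShuffleProtocol X M Z n m) (ε δ : ℝ) : Prop :=
  IsDP ε δ P.shuffled

end ShuffleProtocol

/-- The bit `b`, flipped with probability `q`. -/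
def flipBit (q : unitInterval) (b : Bool) : PMF Bool :=
  PMF.ofFintype (fun c => ENNReal.ofReal (if c = b then 1 - (q : ℝ) else q)) (by
    have h : ENNReal.ofReal (1 - (q : ℝ)) + ENNReal.ofReal (q : ℝ) = 1 := by
      rw [← ENNReal.ofReal_add (sub_nonneg.2 q.2.2) q.2.1]
      simp
    cases b
    · simpa [add_comm] using h
    · simpa using h)

/-- The binary string `v`, each bit of which is flipped independently with probability `q`. -/
def flipBits {d : ℕ} (q : unitInterval) (v : Fin d → Bool) : PMF (Fin d → Bool) :=
  piPMF fun j => flipBit q (v j)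

/-- The local randomizer of the histogram protocol: the first message is the one-hot encoding of
the data `a`, the other `k` messages are zero strings, and every bit of every message is flipped
independently with probability `q`. -/
def flipRandomizer (d k : ℕ) (q : unitInterval) (a : Fin d) : PMF (Fin (k + 1) → Fin d → Bool) :=
  piPMF fun l => flipBits q (fun j => decide (l = 0 ∧ j = a))

/-- The analyzer of the histogram protocol: it de-biases and rescales, for each bin `j`, the number
of the `n (k + 1)` messages whose `j`-th bit is 1. -/
def flipAnalyzer (d n k : ℕ) (q : unitInterval) (y : Fin n × Fin (k + 1) → Fin d → Bool) (j : Fin d) : ℝ :=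
  (1 / (1 - 2 * (q : ℝ))) *
    ((1 / (n : ℝ)) * (∑ p, if y p j then (1 : ℝ) else 0) - (k + 1 : ℝ) * q)

/-- The histogram protocol for `n` users and `d` bins, with `k` fake users per user and bit flipping
probability `q`; each user sends `k + 1` messages of `d` bits. -/
def flipProtocol (d n k : ℕ) (q : unitInterval) :
    ShuffleProtocol (Fin d) (Fin d → Bool) (Fin d → ℝ) n (k + 1) where
  randomizer := flipRandomizer d k q
  analyzer := flipAnalyzer d n k q

/-- The histogram of the dataset `x`: the fraction of users that have data `j`, for each bin `j`. -/
def histogram {d n : ℕ} (x : Fin n → Fin d) (j : Fin d) : ℝ :=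
  (∑ i, if x i = j then (1 : ℝ) else 0) / n

/-- The maximum (`ℓ_∞`) error over all bins of the estimate `z` of the histogram of `x`. -/
def maxError {d n : ℕ} (x : Fin n → Fin d) (z : Fin d → ℝ) : ℝ :=
  ⨆ j, |z j - histogram x j|

/-- The bit flipping probability `q = 1 / (1 + exp (ε₀ / 2))`, where
`exp ε₀ = min(1, ε) ^ 2 n / (80 log (4 / δ))`. -/
def flipProb (n : ℕ) (ε δ : ℝ) : unitInterval :=
  ⟨1 / (1 + Real.sqrt ((min 1 ε) ^ 2 * n / (80 * Real.log (4 / δ)))), by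
    have h := Real.sqrt_nonneg ((min 1 ε) ^ 2 * n / (80 * Real.log (4 / δ)))
    constructor
    · positivity
    · rw [div_le_one (by positivity)]
      linarith⟩

end ShuffleHistogram

end

/-! Privacy rests on hiding among clones. Let user `i₀` send a message with law `f` or `g`. Local
privacy of the randomizer gives every other law `r i ≥ p * f` and `r i ≥ p * g`, so `r i` is `p/2 *
f + p/2 * g` plus a nonnegative remainder: with probability `p` a user acts as a clone of `f` or of
`g`, by a fair coin. A symmetric test cannot tell `i₀` from the clones. If `P` labels are `f` and
`Q` are `g`, with `i₀` counted, then `i₀` holds `f` with weight `P / (P + Q)`, and privacy reduces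
to bounding the mean of `(P - κ * Q) / (P + Q)` (`sum_clone_eq`, `sum_clone_symm`). An exponential
that factorizes over users dominates this quantity, which yields `prodExp_update_le`. For bit
flipping, `p = exp (-ε₀)`, because two one-hot strings differ in at most two bits.

Accuracy is a Chernoff bound. The analyzer sees only bin counts, so the shuffler plays no role. Each
count is a sum of independent bits of variance at most `q`, and a union bound over the bins
(`prodExp_countDev_ge`) gives error of order `log d / n + sqrt (q * log d / n)`; `flipProb_le` then
inserts the size of `q`. -/

noncomputable section
namespace ShuffleHistogram

open Finset

/-! ### Amplification by shuffling through clones -/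

/-- The decomposition of the weight `r i` into clones of `f` and `g` and a remainder; for the
distinguished index `i₀` there is no remainder. -/
def clonePart {ι M : Type*} [DecidableEq ι] (p : ℝ) (i₀ : ι) (f g : M → ℝ) (r : ι → M → ℝ)
    (i : ι) : SignType → M → ℝ
  | .pos => fun m => p / 2 * f m
  | .neg => fun m => p / 2 * g m
  | .zero => fun m => if i = i₀ then 0 else r i m - p / 2 * (f m + g m)

lemma clonePart_zero {ι M : Type*} [DecidableEq ι] (p : ℝ) (i₀ : ι) (f g : M → ℝ)
    (r : ι → M → ℝ) (i : ι) (a : M) :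
    clonePart p i₀ f g r i 0 a = if i = i₀ then 0 else r i a - p / 2 * (f a + g a) := rfl

lemma clonePart_one {ι M : Type*} [DecidableEq ι] (p : ℝ) (i₀ : ι) (f g : M → ℝ)
    (r : ι → M → ℝ) (i : ι) (a : M) :
    clonePart p i₀ f g r i 1 a = p / 2 * f a := rfl

lemma clonePart_neg_one {ι M : Type*} [DecidableEq ι] (p : ℝ) (i₀ : ι) (f g : M → ℝ)
    (r : ι → M → ℝ) (i : ι) (a : M) :
    clonePart p i₀ f g r i (-1) a = p / 2 * g a := rfl

lemma sum_signType (F : SignType → ℝ) : ∑ c, F c = F 0 + F (-1) + F 1 := by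
  have : (Finset.univ : Finset SignType) = {0, -1, 1} := rfl
  rw [this, Finset.sum_insert (by decide), Finset.sum_insert (by decide), Finset.sum_singleton]
  ring

section Amplification

variable {ι M : Type*} [Fintype ι] [DecidableEq ι] [Fintype M]

/-- The expectation of `φ` under the product of the (not necessarily normalized) weights `h i`. -/
def prodExp (φ : (ι → M) → ℝ) (h : ι → M → ℝ) : ℝ :=
  ∑ y : ι → M, (∏ i, h i (y i)) * φ y

lemma prodExp_perm {φ : (ι → M) → ℝ} (hφ : ∀ (σ : Equiv.Perm ι) y, φ (y ∘ σ) = φ y)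
    (h : ι → M → ℝ) (σ : Equiv.Perm ι) : prodExp φ (h ∘ σ) = prodExp φ h := by
  unfold prodExp
  rw [← Equiv.sum_comp (Equiv.arrowCongr σ.symm (Equiv.refl M))]
  refine Finset.sum_congr rfl fun y _ => ?_
  have h1 : (Equiv.arrowCongr σ.symm (Equiv.refl M)) y = y ∘ σ := by
    ext i; simp [Equiv.arrowCongr]
  rw [h1, hφ]
  congr 1
  exact Equiv.prod_comp σ fun i => h i (y i)

lemma prodExp_nonneg {φ : (ι → M) → ℝ} (hφ : ∀ y, 0 ≤ φ y) {h : ι → M → ℝ}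
    (hh : ∀ i m, 0 ≤ h i m) : 0 ≤ prodExp φ h :=
  Finset.sum_nonneg fun y _ => mul_nonneg (Finset.prod_nonneg fun i _ => hh i _) (hφ y)

lemma prodExp_le_prod {φ : (ι → M) → ℝ} (hφ : ∀ y, φ y ≤ 1) {h : ι → M → ℝ}
    (hh : ∀ i m, 0 ≤ h i m) : prodExp φ h ≤ ∏ i, ∑ m, h i m := by
  rw [Finset.prod_univ_sum, Fintype.piFinset_univ]
  exact Finset.sum_le_sum fun y _ =>
    mul_le_of_le_one_right (Finset.prod_nonneg fun i _ => hh i _) (hφ y)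

lemma prodExp_sum {C : Type*} [Fintype C] (φ : (ι → M) → ℝ) (K : ι → C → M → ℝ) :
    prodExp φ (fun i m => ∑ c, K i c m) = ∑ w : ι → C, prodExp φ fun i => K i (w i) := by
  unfold prodExp
  rw [Finset.sum_comm]
  refine Finset.sum_congr rfl fun y _ => ?_
  rw [← Finset.sum_mul, Finset.prod_univ_sum, Fintype.piFinset_univ]

/-- Summing out the labels of the other users restores their full laws `r i`, while fixing the label
of `i₀` leaves `p/2 * f` or `p/2 * g` there. -/
lemma sum_clone_eq (φ : (ι → M) → ℝ) {p : ℝ} {i₀ : ι} {f g : M → ℝ} {r : ι → M → ℝ}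
    {c : SignType} (hc : c ≠ 0) :
    p / 2 * prodExp φ (Function.update r i₀ (if c = 1 then f else g)) =
      ∑ w : ι → SignType, if w i₀ = c then prodExp φ (fun i => clonePart p i₀ f g r i (w i))
        else 0 := by
  -- The condition on `w i₀` is absorbed into the factor at `i₀`, so that the sum over labels still
  -- factorizes.
  have h1 : ∀ w : ι → SignType,
      (if w i₀ = c then prodExp φ (fun i => clonePart p i₀ f g r i (w i)) else 0) =
      prodExp φ (fun i => (fun i b m => if i = i₀ ∧ b ≠ c then 0 else clonePart p i₀ f g r i b m :
        ι → SignType → M → ℝ) i (w i)) := by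
    intro w
    split_ifs with hw
    · congr 1
      ext i m
      dsimp only
      rw [if_neg]
      rintro ⟨rfl, h⟩
      exact h hw
    · refine (Finset.sum_eq_zero fun y _ => ?_).symm
      rw [Finset.prod_eq_zero (Finset.mem_univ i₀), zero_mul]
      simp [hw]
  rw [Finset.sum_congr rfl fun w _ => h1 w,
    ← prodExp_sum φ fun i b m => if i = i₀ ∧ b ≠ c then 0 else clonePart p i₀ f g r i b m,
    prodExp, prodExp, Finset.mul_sum]
  refine Finset.sum_congr rfl fun y _ => ?_
  rw [← mul_assoc]
  congr 1
  rw [← Finset.mul_prod_erase _ _ (Finset.mem_univ i₀),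
    ← Finset.mul_prod_erase _ _ (Finset.mem_univ i₀), ← mul_assoc]
  congr 1
  · rw [sum_signType]
    have hc' : c = 1 ∨ c = -1 := by
      clear h1
      revert c
      decide
    have e1 : ((-1 : SignType) = 1) = False := by decide
    have e2 : ((1 : SignType) = -1) = False := by decide
    have e3 : ((0 : SignType) = -1) = False := by decide
    have e4 : ((0 : SignType) = 1) = False := by decide
    rcases hc' with rfl | rfl <;>
      simp [clonePart_one, clonePart_neg_one, e1, e2, e3, e4]
  · refine Finset.prod_congr rfl fun i hi => ?_
    have hi' := Finset.ne_of_mem_erase hi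
    rw [sum_signType]
    simp only [hi', ne_eq, not_false_eq_true, Function.update_of_ne, false_and, if_false]
    simp only [clonePart_zero, clonePart_one, clonePart_neg_one, hi', if_false]
    ring

/-- Clone weights do not depend on the index, so exchanging two nonzero labels only permutes the
factors, which a symmetric `φ` does not see. -/
lemma prodExp_clone_swap {φ : (ι → M) → ℝ} (hφ : ∀ (σ : Equiv.Perm ι) y, φ (y ∘ σ) = φ y)
    {p : ℝ} {i₀ : ι} {f g : M → ℝ} {r : ι → M → ℝ} {w : ι → SignType} {j : ι}
    (h0 : w i₀ ≠ 0) (hj : w j ≠ 0) :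
    prodExp φ (fun i => clonePart p i₀ f g r i ((w ∘ Equiv.swap i₀ j) i)) =
      prodExp φ (fun i => clonePart p i₀ f g r i (w i)) := by
  rw [← prodExp_perm hφ (fun i => clonePart p i₀ f g r i (w i)) (Equiv.swap i₀ j)]
  congr 1
  have key : ∀ a b : ι, ∀ c : SignType, c ≠ 0 →
      clonePart p i₀ f g r a c = clonePart p i₀ f g r b c := by
    intro a b c hc
    rcases c with _ | _ | _
    · exact absurd rfl hc
    · rfl
    · rfl
  ext i m
  simp only [Function.comp]
  by_cases hi : i = i₀
  · subst hi
    simp only [Equiv.swap_apply_left]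
    rw [key i j _ hj]
  by_cases hi' : i = j
  · subst hi'
    simp only [Equiv.swap_apply_right]
    rw [key i i₀ _ h0]
  · rw [Equiv.swap_apply_of_ne_of_ne hi hi']

lemma prodExp_clone_eq_zero (φ : (ι → M) → ℝ)
    {p : ℝ} {i₀ : ι} {f g : M → ℝ} {r : ι → M → ℝ} {w : ι → SignType} (h0 : w i₀ = 0) :
    prodExp φ (fun i => clonePart p i₀ f g r i (w i)) = 0 := by
  refine Finset.sum_eq_zero fun y _ => ?_
  rw [Finset.prod_eq_zero (Finset.mem_univ i₀), zero_mul]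
  dsimp only
  rw [h0, clonePart_zero, if_pos rfl]

/-- Symmetrization: the distinguished index has label `c` with the same weight as the average
index among those with a nonzero label. -/
lemma sum_clone_symm {φ : (ι → M) → ℝ} (hφ : ∀ (σ : Equiv.Perm ι) y, φ (y ∘ σ) = φ y)
    {p : ℝ} {i₀ : ι} {f g : M → ℝ} {r : ι → M → ℝ} {c : SignType} (hc : c ≠ 0) :
    (∑ w : ι → SignType, if w i₀ = c then prodExp φ (fun i => clonePart p i₀ f g r i (w i))
        else 0) =
      ∑ w : ι → SignType, ((#{j | w j = c} : ℝ) / #{j | w j ≠ 0}) *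
        prodExp φ (fun i => clonePart p i₀ f g r i (w i)) := by
  set G : (ι → SignType) → ℝ := fun w => prodExp φ (fun i => clonePart p i₀ f g r i (w i)) with hG
  -- Double counting: the weight of `w` is spread evenly over the indices `j` with a nonzero label,
  -- and the labels of `i₀` and `j` are then exchanged.
  have h1 : ∀ w : ι → SignType, (if w i₀ = c then G w else 0) =
      ∑ j, if w i₀ = c ∧ w j ≠ 0 then G w / #{j | w j ≠ 0} else 0 := by
    intro w
    by_cases hw : w i₀ = c
    · simp only [hw, true_and, if_true]
      rw [← Finset.sum_filter, Finset.sum_const, nsmul_eq_mul]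
      have : (#{j | w j ≠ 0} : ℝ) ≠ 0 := by
        have : i₀ ∈ ({j | w j ≠ 0} : Finset ι) := by simp [hw, hc]
        exact_mod_cast (Finset.card_pos.2 ⟨_, this⟩).ne'
      field_simp
    · simp [hw]
  have h2 : ∀ w : ι → SignType, ((#{j | w j = c} : ℝ) / #{j | w j ≠ 0}) * G w =
      ∑ j, if w j = c ∧ w i₀ ≠ 0 then G w / #{j | w j ≠ 0} else 0 := by
    intro w
    by_cases hw : w i₀ = 0
    · have : G w = 0 := prodExp_clone_eq_zero φ hw
      simp [this]
    · simp only [hw, ne_eq, not_false_eq_true, and_true]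
      rw [← Finset.sum_filter, Finset.sum_const, nsmul_eq_mul]
      ring
  change (∑ w, if w i₀ = c then G w else 0) = ∑ w : ι → SignType, _ * G w
  rw [Finset.sum_congr rfl fun w _ => h1 w, Finset.sum_congr rfl fun w _ => h2 w,
    Finset.sum_comm, Finset.sum_comm (s := (Finset.univ : Finset (ι → SignType)))]
  refine Finset.sum_congr rfl fun j _ => ?_
  rw [← Equiv.sum_comp (Equiv.arrowCongr (Equiv.swap i₀ j) (Equiv.refl SignType))]
  refine Finset.sum_congr rfl fun w _ => ?_
  have h3 : (Equiv.arrowCongr (Equiv.swap i₀ j) (Equiv.refl SignType)) w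
      = w ∘ Equiv.swap i₀ j := by
    ext i; simp [Equiv.arrowCongr]
  rw [h3]
  have h4 : #{k | (w ∘ Equiv.swap i₀ j) k ≠ 0} = #{k | w k ≠ 0} := by
    refine Finset.card_bij (fun k _ => Equiv.swap i₀ j k) ?_ ?_ ?_
    · intro k hk; simpa using hk
    · intro a _ b _ h; exact (Equiv.swap i₀ j).injective h
    · intro b hb
      exact ⟨Equiv.swap i₀ j b, by simpa using hb, by simp⟩
  rw [h4]
  simp only [Function.comp, Equiv.swap_apply_left, Equiv.swap_apply_right]
  by_cases hw : w j = c ∧ w i₀ ≠ 0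
  · rw [if_pos hw, if_pos hw]
    congr 1
    exact prodExp_clone_swap hφ hw.2 (hw.1 ▸ hc)
  · rw [if_neg hw, if_neg hw]

/-- The left side is at most 1, and it is positive only if `P > κ * Q ≥ (1 + m) * Q`. The exponent
is then nonnegative, because `(1 + m) * (1 - m/3) ≥ 1 + m/3` for `0 ≤ m ≤ 1`. The exponential is
chosen since it is a product over users. -/
lemma signed_count_le_exp {m κ : ℝ} (hm : 0 < m) (hm1 : m ≤ 1) (hκ : 1 + m ≤ κ)
    (w : ι → SignType) :
    ((#{j | w j = 1} : ℝ) / #{j | w j ≠ 0}) - κ * ((#{j | w j = -1} : ℝ) / #{j | w j ≠ 0}) ≤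
      ∏ i, Real.exp (m / 3 * ((w i : ℝ) - m / 3 * |(w i : ℝ)|)) := by
  have hcard : (#{j | w j ≠ 0} : ℝ) = #{j | w j = 1} + #{j | w j = -1} := by
    have : ({j | w j ≠ 0} : Finset ι) =
        ({j | w j = 1} : Finset ι) ∪ ({j | w j = -1} : Finset ι) := by
      ext j
      simp only [Finset.mem_filter, Finset.mem_univ, true_and, Finset.mem_union]
      generalize w j = c
      revert c; decide
    rw [this, Finset.card_union_of_disjoint]
    · push_cast; rfl
    · rw [Finset.disjoint_filter]
      intro j _ h
      rw [h]; decide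
  have hs : ∑ i, ((w i : ℝ) - m / 3 * |(w i : ℝ)|) =
      (#{j | w j = 1} : ℝ) - #{j | w j = -1} -
        m / 3 * ((#{j | w j = 1} : ℝ) + #{j | w j = -1}) := by
    simp only [Finset.card_filter]
    push_cast
    rw [← Finset.sum_sub_distrib, ← Finset.sum_add_distrib, Finset.mul_sum,
      ← Finset.sum_sub_distrib]
    refine Finset.sum_congr rfl fun i _ => ?_
    generalize w i = c
    have e1 : ((-1 : SignType) = 1) = False := by decide
    have e2 : ((1 : SignType) = -1) = False := by decide
    have e3 : ((0 : SignType) = -1) = False := by decide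
    have e4 : ((0 : SignType) = 1) = False := by decide
    rcases c with _ | _ | _
    · rw [show SignType.zero = 0 from rfl]; simp [e3, e4]
    · rw [show SignType.neg = -1 from rfl]; simp [e1]
    · rw [show SignType.pos = 1 from rfl]; simp [e2]
  rw [← Real.exp_sum, ← Finset.mul_sum, hs, hcard]
  generalize hP : (#{j | w j = 1} : ℝ) = P
  generalize hQ : (#{j | w j = -1} : ℝ) = Q
  have hP0 : 0 ≤ P := by rw [← hP]; positivity
  have hQ0 : 0 ≤ Q := by rw [← hQ]; positivity
  by_cases h : P ≤ κ * Q
  · refine le_trans ?_ (Real.exp_pos _).le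
    rw [← mul_div_assoc, ← sub_div]
    exact div_nonpos_of_nonpos_of_nonneg (by linarith) (by positivity)
  · push Not at h
    have h5 : (1 + m) * Q ≤ κ * Q := mul_le_mul_of_nonneg_right hκ hQ0
    have h1 : 0 ≤ m / 3 * (P - Q - m / 3 * (P + Q)) := by
      refine mul_nonneg (by linarith) ?_
      have : (1 + m) * Q * (1 - m / 3) ≤ P * (1 - m / 3) :=
        mul_le_mul_of_nonneg_right (by linarith) (by linarith)
      nlinarith [mul_nonneg hQ0 (mul_nonneg hm.le (sub_nonneg.2 hm1))]
    have h6 : 0 ≤ κ * (Q / (P + Q)) := by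
      have : 0 ≤ κ := by linarith
      positivity
    have h7 : P / (P + Q) ≤ 1 := div_le_one_of_le₀ (by linarith) (by linarith)
    linarith [Real.one_le_exp h1]

/-- The moment generating function of a clone label. -/
lemma clone_mgf_le {p m : ℝ} (hp : 0 ≤ p) (hm : 0 ≤ m) (hm1 : m ≤ 1) (a : ℝ) :
    a + p / 2 * Real.exp (m / 3 * (-1 - m / 3)) + p / 2 * Real.exp (m / 3 * (1 - m / 3)) ≤
      a + p * (1 - m ^ 2 / 36) := by
  have h1 : Real.exp (m / 3 * (-1 - m / 3)) / 2 + Real.exp (m / 3 * (1 - m / 3)) / 2 =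
      Real.cosh (m / 3) * Real.exp (-(m / 3) ^ 2) := by
    rw [Real.cosh_eq, show m / 3 * (-1 - m / 3) = -(m / 3) + -(m / 3) ^ 2 by ring,
      show m / 3 * (1 - m / 3) = (m / 3) + -(m / 3) ^ 2 by ring, Real.exp_add, Real.exp_add]
    ring
  have h2 : Real.cosh (m / 3) * Real.exp (-(m / 3) ^ 2) ≤ Real.exp (-(m ^ 2 / 18)) := by
    calc _ ≤ Real.exp ((m / 3) ^ 2 / 2) * Real.exp (-(m / 3) ^ 2) :=
          mul_le_mul_of_nonneg_right (Real.cosh_le_exp_half_sq _) (Real.exp_pos _).le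
      _ = _ := by rw [← Real.exp_add]; congr 1; ring
  -- With `x = m ^ 2 / 18 ≤ 1`, this is `(1 - x/2) * (1 + x) ≥ 1`.
  have h3 : Real.exp (-(m ^ 2 / 18)) ≤ 1 - m ^ 2 / 36 := by
    have h4 : 1 + m ^ 2 / 18 ≤ Real.exp (m ^ 2 / 18) := by
      linarith [Real.add_one_le_exp (m ^ 2 / 18)]
    rw [Real.exp_neg, inv_le_iff_one_le_mul₀ (Real.exp_pos _)]
    have h5 : m ^ 2 ≤ 1 := by nlinarith
    have : 1 ≤ (1 - m ^ 2 / 36) * (1 + m ^ 2 / 18) := by nlinarith [sq_nonneg m]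
    exact this.trans (mul_le_mul_of_nonneg_left h4 (by linarith))
  nlinarith [mul_le_mul_of_nonneg_left (h1.le.trans (h2.trans h3)) hp]

/-- Amplification by shuffling, for a symmetric test `φ`. -/
theorem prodExp_update_le {φ : (ι → M) → ℝ} (hφ : ∀ (σ : Equiv.Perm ι) y, φ (y ∘ σ) = φ y)
    (hφ0 : ∀ y, 0 ≤ φ y) (hφ1 : ∀ y, φ y ≤ 1)
    {p m κ : ℝ} (hp : 0 < p) (hp1 : p ≤ 1) (hm : 0 < m) (hm1 : m ≤ 1) (hκ : 1 + m ≤ κ)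
    (i₀ : ι) {f g : M → ℝ} {r : ι → M → ℝ} (hf : ∀ a, 0 ≤ f a) (hg : ∀ a, 0 ≤ g a)
    (hrf : ∀ i a, p * f a ≤ r i a) (hrg : ∀ i a, p * g a ≤ r i a)
    (hf1 : ∑ a, f a = 1) (hg1 : ∑ a, g a = 1) (hr1 : ∀ i, ∑ a, r i a = 1) :
    prodExp φ (Function.update r i₀ f) ≤
      κ * prodExp φ (Function.update r i₀ g) +
        2 * Real.exp (-(Fintype.card ι * p * m ^ 2 / 36)) := by
  have hF := sum_clone_eq φ (p := p) (i₀ := i₀) (f := f) (g := g) (r := r)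
    (c := 1) (by decide)
  have hG := sum_clone_eq φ (p := p) (i₀ := i₀) (f := f) (g := g) (r := r)
    (c := -1) (by decide)
  rw [sum_clone_symm hφ (by decide)] at hF hG
  rw [if_pos rfl] at hF
  rw [if_neg (by decide)] at hG
  have hK : ∀ i c a, 0 ≤ clonePart p i₀ f g r i c a := by
    intro i c a
    rcases c with _ | _ | _
    · simp only [clonePart]
      split_ifs
      · exact le_rfl
      · nlinarith [hrf i a, hrg i a]
    · exact mul_nonneg (by positivity) (hg a)
    · exact mul_nonneg (by positivity) (hf a)
  -- The exponential bound on the counts turns the sum over all labelings into a product of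
  -- one-label generating functions; `φ ≤ 1` replaces the test by the total mass.
  have h1 : p / 2 * prodExp φ (Function.update r i₀ f) -
      κ * (p / 2 * prodExp φ (Function.update r i₀ g)) ≤
      ∏ i, ∑ c : SignType, (Real.exp (m / 3 * ((c : ℝ) - m / 3 * |(c : ℝ)|)) *
        ∑ a, clonePart p i₀ f g r i c a) := by
    rw [hF, hG, Finset.mul_sum, ← Finset.sum_sub_distrib, Finset.prod_univ_sum,
      Fintype.piFinset_univ]
    refine Finset.sum_le_sum fun w _ => ?_
    rw [← mul_assoc, ← sub_mul, Finset.prod_mul_distrib]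
    exact mul_le_mul (signed_count_le_exp hm hm1 hκ w)
      (prodExp_le_prod hφ1 fun i a => hK i _ a)
      (prodExp_nonneg hφ0 fun i a => hK i _ a)
      (Finset.prod_nonneg fun i _ => (Real.exp_pos _).le)
  have h2 : ∀ i, ∑ c : SignType, (Real.exp (m / 3 * ((c : ℝ) - m / 3 * |(c : ℝ)|)) *
        ∑ a, clonePart p i₀ f g r i c a) ≤
      (if i = i₀ then 0 else 1 - p) + p * (1 - m ^ 2 / 36) := by
    intro i
    refine le_trans (le_of_eq ?_) (clone_mgf_le hp.le hm.le hm1 _)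
    rw [sum_signType]
    have e1 : ∑ a, clonePart p i₀ f g r i 1 a = p / 2 := by
      change ∑ a, p / 2 * f a = _
      rw [← Finset.mul_sum, hf1, mul_one]
    have e2 : ∑ a, clonePart p i₀ f g r i (-1) a = p / 2 := by
      change ∑ a, p / 2 * g a = _
      rw [← Finset.mul_sum, hg1, mul_one]
    have e3 : ∑ a, clonePart p i₀ f g r i 0 a = if i = i₀ then 0 else 1 - p := by
      change ∑ a, (if i = i₀ then 0 else r i a - p / 2 * (f a + g a)) = _
      split_ifs
      · simp
      · rw [Finset.sum_sub_distrib, ← Finset.mul_sum, Finset.sum_add_distrib, hf1, hg1, hr1]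
        ring
    rw [e1, e2, e3]
    simp
    ring
  have hm2 : m ^ 2 ≤ 1 := by nlinarith
  -- The leading `p` is the mass at `i₀`, which has no remainder. Dividing by `p / 2` at the end
  -- leaves the factor 2.
  have h3 : ∏ i, ((if i = i₀ then 0 else 1 - p) + p * (1 - m ^ 2 / 36)) ≤
      p * Real.exp (-(Fintype.card ι * p * m ^ 2 / 36)) := by
    have e1 : Real.exp (-(Fintype.card ι * p * m ^ 2 / 36)) =
        ∏ _i : ι, Real.exp (-(p * m ^ 2 / 36)) := by
      rw [Finset.prod_const, Finset.card_univ, ← Real.exp_nat_mul]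
      congr 1; ring
    have e2 : 1 - m ^ 2 / 36 ≤ Real.exp (-(p * m ^ 2 / 36)) := by
      nlinarith [Real.add_one_le_exp (-(p * m ^ 2 / 36)), sq_nonneg m]
    rw [e1, ← Finset.mul_prod_erase _ _ (Finset.mem_univ i₀),
      ← Finset.mul_prod_erase _ (fun _ => Real.exp (-(p * m ^ 2 / 36))) (Finset.mem_univ i₀),
      ← mul_assoc]
    refine mul_le_mul ?_ ?_ ?_ (by positivity)
    · rw [if_pos rfl, zero_add]
      exact mul_le_mul_of_nonneg_left e2 hp.le
    · refine Finset.prod_le_prod ?_ ?_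
      · intro i hi
        rw [if_neg (Finset.ne_of_mem_erase hi)]
        nlinarith
      · intro i hi
        rw [if_neg (Finset.ne_of_mem_erase hi)]
        nlinarith [Real.add_one_le_exp (-(p * m ^ 2 / 36))]
    · refine Finset.prod_nonneg fun i hi => ?_
      rw [if_neg (Finset.ne_of_mem_erase hi)]
      nlinarith
  have h4 := h1.trans ((Finset.prod_le_prod (fun i _ => Finset.sum_nonneg fun c _ =>
    mul_nonneg (Real.exp_pos _).le (Finset.sum_nonneg fun a _ => hK i c a))
    fun i _ => h2 i).trans h3)
  have h5 : p / 2 * (prodExp φ (Function.update r i₀ f) -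
      κ * prodExp φ (Function.update r i₀ g)) ≤
      p / 2 * (2 * Real.exp (-(Fintype.card ι * p * m ^ 2 / 36))) := by
    linarith
  linarith [le_of_mul_le_mul_left h5 (by positivity)]

end Amplification

/-! ### From symmetric tests to shuffle privacy -/

lemma piPMF_apply {ι α : Type*} [Fintype ι] [DecidableEq ι] [Fintype α] (p : ι → PMF α)
    (y : ι → α) : piPMF p y = ∏ i, p i (y i) := rfl

lemma sum_toReal_eq_one {α : Type*} [Fintype α] (p : PMF α) : ∑ a, (p a).toReal = 1 := by
  rw [← ENNReal.toReal_sum fun a _ => p.apply_ne_top a, ← tsum_fintype (L := .unconditional _),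
    p.tsum_coe, ENNReal.toReal_one]

lemma toOuterMeasure_le_one {α : Type*} (p : PMF α) (s : Set α) : p.toOuterMeasure s ≤ 1 := by
  have h := p.toOuterMeasure.mono (Set.subset_univ s)
  refine h.trans (le_of_eq ?_)
  change p.toOuterMeasure Set.univ = 1
  rw [PMF.toOuterMeasure_apply]
  simp

lemma toOuterMeasure_ne_top {α : Type*} (p : PMF α) (s : Set α) : p.toOuterMeasure s ≠ ⊤ :=
  ne_top_of_le_ne_top ENNReal.one_ne_top (toOuterMeasure_le_one p s)

/-- Up to definitional equality, `shuffle` first pushes the uniform permutation forward to a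
function `ι → ι`; the two maps are fused here. -/
lemma shuffle_eq_map {ι M : Type*} [Fintype ι] [DecidableEq ι] (y : ι → M) :
    shuffle y = (PMF.uniformOfFintype (Equiv.Perm ι)).map fun σ : Equiv.Perm ι => y ∘ ⇑σ := by
  unfold shuffle
  change PMF.map (fun σ : ι → ι => y ∘ σ) (PMF.map (fun σ : Equiv.Perm ι => ⇑σ) _) = _
  rw [PMF.map_comp]
  rfl

/-- The shuffler forgets the order of the messages. -/
lemma shuffle_perm {ι M : Type*} [Fintype ι] [DecidableEq ι] (y : ι → M) (σ : Equiv.Perm ι) :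
    shuffle (y ∘ σ) = shuffle y := by
  rw [shuffle_eq_map, shuffle_eq_map]
  ext z
  symm
  rw [PMF.map_apply, PMF.map_apply, ← Equiv.tsum_eq (Equiv.mulLeft σ)]
  refine tsum_congr fun τ => ?_
  have : (y ∘ σ) ∘ τ = y ∘ ⇑((Equiv.mulLeft σ) τ) := by
    ext i; simp
  rw [this]
  simp [PMF.uniformOfFintype_apply]

section Privacy

variable {X M Z : Type*} {n m : ℕ}

/-- The probability that the shuffled messages are in `T`, given the messages of the users. -/
def shuffleProb (T : Set (Fin n × Fin m → M)) (y : Fin n → Fin m → M) : ℝ :=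
  ((shuffle fun p : Fin n × Fin m => y p.1 p.2).toOuterMeasure T).toReal

/-- Permuting users moves whole blocks of messages, a special case of permuting messages. This is
the symmetry that `prodExp_update_le` requires. -/
lemma shuffleProb_perm (T : Set (Fin n × Fin m → M)) (σ : Equiv.Perm (Fin n))
    (y : Fin n → Fin m → M) : shuffleProb T (y ∘ σ) = shuffleProb T y := by
  unfold shuffleProb
  rw [← shuffle_perm (fun p : Fin n × Fin m => y p.1 p.2) (Equiv.prodCongr σ (Equiv.refl _))]
  rfl

variable [Fintype M]

lemma shuffled_toReal (P : ShuffleProtocol X M Z n m) (x : Fin n → X)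
    (T : Set (Fin n × Fin m → M)) :
    ((P.shuffled x).toOuterMeasure T).toReal =
      prodExp (shuffleProb T) fun i a => (P.randomizer (x i) a).toReal := by
  unfold ShuffleProtocol.shuffled
  rw [PMF.toOuterMeasure_bind_apply, tsum_fintype, ENNReal.toReal_sum, prodExp]
  · refine Finset.sum_congr rfl fun y _ => ?_
    rw [ENNReal.toReal_mul, piPMF_apply, ENNReal.toReal_prod]
    rfl
  · intro y _
    exact ENNReal.mul_ne_top (PMF.apply_ne_top _ _) (toOuterMeasure_ne_top _ _)

/-- Amplification by shuffling: a protocol whose local randomizer is `log (1 / p)`-differentially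
private is shuffle private. -/
theorem isShufflePrivate_of_local (P : ShuffleProtocol X M Z n m) {p ε δ : ℝ} (hp : 0 < p)
    (hp1 : p ≤ 1) (hε : 0 < ε) (hδ : 0 < δ)
    (hP : ∀ a b y, p * (P.randomizer a y).toReal ≤ (P.randomizer b y).toReal)
    (h : 2 * Real.exp (-(n * p * (min 1 ε) ^ 2 / 36)) ≤ δ) : P.IsShufflePrivate ε δ := by
  rintro x x' ⟨i₀, hx⟩ T
  have key := prodExp_update_le (φ := shuffleProb T) (shuffleProb_perm T)
    (fun y => ENNReal.toReal_nonneg)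
    (fun y => by
      have := ENNReal.toReal_mono ENNReal.one_ne_top
        (toOuterMeasure_le_one (shuffle fun p : Fin n × Fin m => y p.1 p.2) T)
      simpa [shuffleProb] using this)
    hp hp1 (m := min 1 ε) (κ := Real.exp ε) (by positivity) (min_le_left _ _)
    (by linarith [min_le_right 1 ε, Real.add_one_le_exp ε]) i₀
    (f := fun a => (P.randomizer (x i₀) a).toReal)
    (g := fun a => (P.randomizer (x' i₀) a).toReal)
    (r := fun i a => (P.randomizer (x i) a).toReal)
    (fun _ => ENNReal.toReal_nonneg) (fun _ => ENNReal.toReal_nonneg)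
    (fun _ _ => hP _ _ _) (fun _ _ => hP _ _ _) (sum_toReal_eq_one _) (sum_toReal_eq_one _)
    (fun _ => sum_toReal_eq_one _)
  have e1 : Function.update (fun i a => (P.randomizer (x i) a).toReal) i₀
      (fun a => (P.randomizer (x i₀) a).toReal) = fun i a => (P.randomizer (x i) a).toReal :=
    Function.update_eq_self i₀ _
  have e2 : Function.update (fun i a => (P.randomizer (x i) a).toReal) i₀
      (fun a => (P.randomizer (x' i₀) a).toReal) = fun i a => (P.randomizer (x' i) a).toReal := by
    funext i
    by_cases hi : i = i₀
    · subst hi; simp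
    · rw [Function.update_of_ne hi, hx i hi]
  rw [e1, e2, Fintype.card_fin, ← shuffled_toReal, ← shuffled_toReal] at key
  rw [← ENNReal.ofReal_toReal (toOuterMeasure_ne_top (P.shuffled x) T),
    ← ENNReal.ofReal_toReal (toOuterMeasure_ne_top (P.shuffled x') T),
    ← ENNReal.ofReal_mul (Real.exp_pos _).le,
    ← ENNReal.ofReal_add (mul_nonneg (Real.exp_pos _).le ENNReal.toReal_nonneg) hδ.le]
  exact ENNReal.ofReal_le_ofReal (by linarith)

end Privacy

/-! ### Randomized response and the privacy claim -/

lemma flipBit_toReal (q : unitInterval) (b c : Bool) :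
    (flipBit q b c).toReal = if c = b then 1 - (q : ℝ) else q := by
  change (ENNReal.ofReal (if c = b then 1 - (q : ℝ) else q)).toReal = _
  rw [ENNReal.toReal_ofReal]
  split_ifs
  · linarith [q.2.2]
  · exact q.2.1

lemma flipBits_toReal {d : ℕ} (q : unitInterval) (v c : Fin d → Bool) :
    (flipBits q v c).toReal = ∏ j, (flipBit q (v j) (c j)).toReal := by
  rw [flipBits, piPMF_apply, ENNReal.toReal_prod]

/-- Local privacy of randomized response. -/
lemma flipRandomizer_le {d : ℕ} {q : unitInterval} {s : ℝ} (hs : 0 ≤ s) (hs1 : s ≤ 1)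
    (hq : s * (1 - q) ≤ q) (hq2 : (q : ℝ) ≤ 1 / 2) (a b : Fin d) (y : Fin 1 → Fin d → Bool) :
    s ^ 2 * (flipRandomizer d 0 q a y).toReal ≤ (flipRandomizer d 0 q b y).toReal := by
  have hq0 := q.2.1
  have hq1 := q.2.2
  have hbit : ∀ u v c : Bool, (if u = v then 1 else s) * (flipBit q u c).toReal ≤
      (flipBit q v c).toReal := by
    intro u v c
    rw [flipBit_toReal, flipBit_toReal]
    by_cases h : u = v
    · simp [h]
    · rw [if_neg h]
      rcases eq_or_ne c u with rfl | hc
      · rw [if_pos rfl, if_neg h]; exact hq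
      · have : c = v := by revert u v c; decide
        rw [if_neg hc, if_pos this]
        nlinarith
  unfold flipRandomizer
  rw [piPMF_apply, piPMF_apply, Fin.prod_univ_one, Fin.prod_univ_one, flipBits_toReal,
    flipBits_toReal]
  -- Only the bits `a` and `b` can differ between the two one-hot strings, and each costs a factor
  -- `s`.
  have h2 : s ^ 2 ≤ ∏ j, (if decide ((0 : Fin 1) = 0 ∧ j = a) = decide ((0 : Fin 1) = 0 ∧ j = b)
      then 1 else s) := by
    rw [Finset.prod_ite, Finset.prod_const_one, one_mul, Finset.prod_const]
    refine pow_le_pow_of_le_one hs hs1 ?_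
    refine (Finset.card_le_card (t := {a, b}) ?_).trans Finset.card_le_two
    intro j hj
    simp only [true_and, Finset.mem_filter, Finset.mem_univ, decide_eq_decide] at hj
    simp only [Finset.mem_insert, Finset.mem_singleton]
    tauto
  refine (mul_le_mul_of_nonneg_right h2
    (Finset.prod_nonneg fun j _ => ENNReal.toReal_nonneg)).trans ?_
  rw [← Finset.prod_mul_distrib]
  refine Finset.prod_le_prod (fun j _ => mul_nonneg ?_ ENNReal.toReal_nonneg) fun j _ =>
    hbit _ _ _
  split_ifs <;> linarith

lemma coe_flipProb (n : ℕ) (ε δ : ℝ) : (flipProb n ε δ : ℝ) =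
    1 / (1 + Real.sqrt ((min 1 ε) ^ 2 * n / (80 * Real.log (4 / δ)))) := rfl

theorem flipProtocol_isShufflePrivate (d n : ℕ) {ε δ : ℝ} (hε : 0 < ε) (hδ : 0 < δ) (hδ1 : δ < 1)
    (hn : 80 * Real.log (4 / δ) ≤ (min 1 ε) ^ 2 * n) :
    (flipProtocol d n 0 (flipProb n ε δ)).IsShufflePrivate ε δ := by
  have hL : 0 < Real.log (4 / δ) := Real.log_pos (by rw [lt_div_iff₀ hδ]; linarith)
  set L := Real.log (4 / δ) with hLdef
  set A := (min 1 ε) ^ 2 * n / (80 * L) with hA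
  have hA1 : 1 ≤ A := by rw [hA, le_div_iff₀ (by positivity)]; linarith
  have hs1 : 1 ≤ Real.sqrt A := Real.one_le_sqrt.2 hA1
  have hsq : Real.sqrt A ^ 2 = A := Real.sq_sqrt (by linarith)
  -- Here `1 / sqrt A = q / (1 - q)` is the likelihood ratio of one bit, and its square is `exp
  -- (-ε₀)`.
  refine isShufflePrivate_of_local _ (p := (1 / Real.sqrt A) ^ 2) (by positivity)
    (pow_le_one₀ (by positivity) (by rw [div_le_one (by positivity)]; exact hs1)) hε hδ
    (fun a b y => flipRandomizer_le (by positivity)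
      (by rw [div_le_one (by positivity)]; exact hs1) (le_of_eq ?_) ?_ a b y) ?_
  · rw [coe_flipProb, ← hA]
    have : Real.sqrt A ≠ 0 := by positivity
    field_simp
    ring
  · rw [coe_flipProb, ← hA]
    exact one_div_le_one_div_of_le (by norm_num) (by linarith)
  · have hm : 0 < min 1 ε := by positivity
    have hn0 : (0 : ℝ) < n := by
      by_contra hcon
      have : (n : ℝ) = 0 := le_antisymm (not_lt.1 hcon) (Nat.cast_nonneg n)
      rw [this] at hn
      linarith
    -- Since `80 / 36 ≥ 1`, the failure term is at most `2 * exp (-L) = δ / 2`.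
    have e1 : n * (1 / Real.sqrt A) ^ 2 * (min 1 ε) ^ 2 / 36 = 80 / 36 * L := by
      rw [div_pow, hsq, hA]
      field_simp
    rw [e1]
    have e2 : Real.exp (-L) = δ / 4 := by
      rw [hLdef, Real.exp_neg, Real.exp_log (by positivity), inv_div]
    have e3 : Real.exp (-(80 / 36 * L)) ≤ Real.exp (-L) := Real.exp_le_exp.2 (by linarith)
    linarith

/-! ### Reduction of the output to unshuffled messages -/

lemma prodExp_mono {ι M : Type*} [Fintype ι] [DecidableEq ι] [Fintype M] {φ ψ : (ι → M) → ℝ}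
    (h : ∀ y, φ y ≤ ψ y) {p : ι → M → ℝ} (hp : ∀ i m, 0 ≤ p i m) :
    prodExp φ p ≤ prodExp ψ p :=
  Finset.sum_le_sum fun y _ =>
    mul_le_mul_of_nonneg_left (h y) (Finset.prod_nonneg fun i _ => hp i _)

lemma prodExp_const_mul_prod {ι M : Type*} [Fintype ι] [DecidableEq ι] [Fintype M]
    (c : ℝ) (F : ι → M → ℝ) (p : ι → M → ℝ) :
    prodExp (fun y => c * ∏ i, F i (y i)) p = c * ∏ i, ∑ a, p i a * F i a := by
  rw [Finset.prod_univ_sum, Fintype.piFinset_univ, Finset.mul_sum, prodExp]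
  refine Finset.sum_congr rfl fun y _ => ?_
  rw [Finset.prod_mul_distrib]
  ring

lemma prodExp_add {ι M : Type*} [Fintype ι] [DecidableEq ι] [Fintype M]
    (φ ψ : (ι → M) → ℝ) (p : ι → M → ℝ) :
    prodExp (fun y => φ y + ψ y) p = prodExp φ p + prodExp ψ p := by
  unfold prodExp
  rw [← Finset.sum_add_distrib]
  exact Finset.sum_congr rfl fun y _ => mul_add _ _ _

lemma prodExp_sub_sum {ι M κ : Type*} [Fintype ι] [DecidableEq ι] [Fintype M] [Fintype κ]
    (φ : (ι → M) → ℝ) (ψ : κ → (ι → M) → ℝ) (p : ι → M → ℝ) :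
    prodExp (fun y => φ y - ∑ j, ψ j y) p = prodExp φ p - ∑ j, prodExp (ψ j) p := by
  unfold prodExp
  simp only [mul_sub, Finset.sum_sub_distrib, Finset.mul_sum]
  rw [Finset.sum_comm]

lemma shuffle_toOuterMeasure {ι M : Type*} [Fintype ι] [DecidableEq ι] {y : ι → M}
    {S : Set (ι → M)} (hS : ∀ σ : Equiv.Perm ι, y ∘ σ ∈ S ↔ y ∈ S) :
    (shuffle y).toOuterMeasure S = S.indicator 1 y := by
  rw [shuffle_eq_map, PMF.toOuterMeasure_map_apply]
  by_cases hy : y ∈ S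
  · have : (fun σ : Equiv.Perm ι => y ∘ σ) ⁻¹' S = Set.univ := by
      ext σ; simp [hS, hy]
    rw [this, Set.indicator_of_mem hy, PMF.toOuterMeasure_apply]
    simpa using (PMF.uniformOfFintype (Equiv.Perm ι)).tsum_coe
  · have : (fun σ : Equiv.Perm ι => y ∘ σ) ⁻¹' S = ∅ := by
      ext σ; simp [hS, hy]
    rw [this, Set.indicator_of_notMem hy]
    simp

lemma flipAnalyzer_perm (d n k : ℕ) (q : unitInterval) (y : Fin n × Fin (k + 1) → Fin d → Bool)
    (σ : Equiv.Perm (Fin n × Fin (k + 1))) :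
    flipAnalyzer d n k q (y ∘ σ) = flipAnalyzer d n k q y := by
  funext j
  unfold flipAnalyzer
  rw [← Equiv.sum_comp σ fun p => if y p j then (1 : ℝ) else 0]
  rfl

lemma output_toReal (d n k : ℕ) (q : unitInterval) (x : Fin n → Fin d) (S : Set (Fin d → ℝ)) :
    (((flipProtocol d n k q).output x).toOuterMeasure S).toReal =
      prodExp (fun y : Fin n → Fin (k + 1) → Fin d → Bool =>
          S.indicator 1 (flipAnalyzer d n k q fun p => y p.1 p.2))
        fun i a => (flipRandomizer d k q (x i) a).toReal := by
  unfold ShuffleProtocol.output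
  rw [PMF.toOuterMeasure_map_apply, shuffled_toReal]
  congr 1
  funext y
  unfold shuffleProb
  rw [shuffle_toOuterMeasure]
  · by_cases h : flipAnalyzer d n k q (fun p => y p.1 p.2) ∈ S
    · rw [Set.indicator_of_mem h,
        Set.indicator_of_mem (show _ ∈ (flipProtocol d n k q).analyzer ⁻¹' S from h)]
      simp
    · rw [Set.indicator_of_notMem h,
        Set.indicator_of_notMem (show _ ∉ (flipProtocol d n k q).analyzer ⁻¹' S from h)]
      simp
  · intro σ
    simp only [Set.mem_preimage, flipProtocol, flipAnalyzer_perm]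

/-! ### Concentration of the bin counts -/

/-- The probability that a bit `b` is 1 after it is flipped with probability `q`. -/
def flipMean (q : unitInterval) (b : Bool) : ℝ := if b then 1 - (q : ℝ) else q

/-- From `exp u ≤ 1 + u + u ^ 2` for `|u| ≤ 1`: the linear term has mean zero and the variance `q *
(1 - q)` is at most `q`. -/
lemma flipBit_mgf_le (q : unitInterval) (b : Bool) {l : ℝ} (hl : |l| ≤ 1) :
    ∑ c, (flipBit q b c).toReal * Real.exp (l * ((if c then 1 else 0) - flipMean q b)) ≤
      Real.exp (l ^ 2 * q) := by
  have hq0 := q.2.1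
  have hq1 := q.2.2
  have hexp : ∀ u : ℝ, |u| ≤ 1 → Real.exp (l * u) ≤ 1 + l * u + (l * u) ^ 2 := by
    intro u hu
    have h1 : |l * u| ≤ 1 := by
      rw [abs_mul]; exact mul_le_one₀ hl (abs_nonneg _) hu
    have := (abs_le.1 (Real.abs_exp_sub_one_sub_id_le h1)).2
    linarith
  have h2 := Real.add_one_le_exp (l ^ 2 * (q : ℝ))
  have h3 : 0 ≤ l ^ 2 * (q : ℝ) ^ 2 := by positivity
  rw [Fintype.sum_bool, flipBit_toReal, flipBit_toReal]
  cases b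
  · have e1 := hexp (1 - (q : ℝ)) (by rw [abs_le]; constructor <;> linarith)
    have e2 := hexp (0 - (q : ℝ)) (by rw [abs_le]; constructor <;> linarith)
    have e3 := mul_le_mul_of_nonneg_left e1 hq0
    have e4 := mul_le_mul_of_nonneg_left e2 (sub_nonneg.2 hq1)
    simp [flipMean] at e3 e4 ⊢
    nlinarith
  · have e1 := hexp (1 - (1 - (q : ℝ))) (by rw [abs_le]; constructor <;> linarith)
    have e2 := hexp (0 - (1 - (q : ℝ))) (by rw [abs_le]; constructor <;> linarith)
    have e3 := mul_le_mul_of_nonneg_left e1 (sub_nonneg.2 hq1)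
    have e4 := mul_le_mul_of_nonneg_left e2 hq0
    simp [flipMean] at e3 e4 ⊢
    nlinarith

/-- The marginal distribution of one bit of a message. -/
lemma flipRandomizer_marginal {d : ℕ} (q : unitInterval) (a j : Fin d) (F : Bool → ℝ) :
    ∑ y, (flipRandomizer d 0 q a y).toReal * F (y 0 j) =
      ∑ c, (flipBit q (decide (j = a)) c).toReal * F c := by
  rw [← Equiv.sum_comp (Equiv.funUnique (Fin 1) (Fin d → Bool)).symm]
  -- `F` is attached to the factor of bit `j`; after the sum is factorized, every other factor is 1.
  have h1 : ∀ v : Fin d → Bool,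
      (flipRandomizer d 0 q a ((Equiv.funUnique (Fin 1) (Fin d → Bool)).symm v)).toReal *
        F ((Equiv.funUnique (Fin 1) (Fin d → Bool)).symm v 0 j) =
      ∏ i, (flipBit q (decide (i = a)) (v i)).toReal * (if i = j then F (v i) else 1) := by
    intro v
    unfold flipRandomizer
    rw [piPMF_apply, Fin.prod_univ_one, flipBits_toReal, Finset.prod_mul_distrib,
      Finset.prod_ite_eq' univ j fun i => F (v i)]
    simp
  rw [Finset.sum_congr rfl fun v _ => h1 v]
  have h2 := Finset.prod_univ_sum (fun _ : Fin d => (Finset.univ : Finset Bool))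
    fun i c => (flipBit q (decide (i = a)) c).toReal * (if i = j then F c else 1)
  rw [Fintype.piFinset_univ] at h2
  rw [← h2, Finset.prod_eq_single j]
  · simp
  · intro i _ hi
    simp only [hi, if_false, mul_one]
    exact sum_toReal_eq_one _
  · simp

/-- The deviation of the number of messages with bit `j` set from its mean. -/
def countDev {d n : ℕ} (q : unitInterval) (x : Fin n → Fin d) (y : Fin n → Fin 1 → Fin d → Bool)
    (j : Fin d) : ℝ :=
  ∑ i, ((if y i 0 j then 1 else 0) - flipMean q (decide (j = x i)))

lemma prodExp_exp_countDev_le {d n : ℕ} (q : unitInterval) (x : Fin n → Fin d) (j : Fin d)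
    {l : ℝ} (hl : |l| ≤ 1) (t : ℝ) :
    prodExp (fun y => Real.exp (l * countDev q x y j - t))
      (fun i a => (flipRandomizer d 0 q (x i) a).toReal) ≤ Real.exp (n * l ^ 2 * q - t) := by
  have h1 : (fun y : Fin n → Fin 1 → Fin d → Bool => Real.exp (l * countDev q x y j - t)) =
      fun y => Real.exp (-t) * ∏ i, (fun (i : Fin n) (a : Fin 1 → Fin d → Bool) =>
        Real.exp (l * ((if a 0 j then 1 else 0) - flipMean q (decide (j = x i))))) i (y i) := by
    funext y
    rw [← Real.exp_sum, ← Real.exp_add, countDev, Finset.mul_sum]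
    congr 1; ring
  have h2 : Real.exp (n * l ^ 2 * q - t) = Real.exp (-t) * ∏ _i : Fin n, Real.exp (l ^ 2 * q) := by
    rw [Finset.prod_const, Finset.card_univ, Fintype.card_fin, ← Real.exp_nat_mul, ← Real.exp_add]
    congr 1; ring
  rw [h1, h2]
  refine (prodExp_const_mul_prod (Real.exp (-t)) (fun (i : Fin n) (a : Fin 1 → Fin d → Bool) =>
    Real.exp (l * ((if a 0 j then 1 else 0) - flipMean q (decide (j = x i))))) _).le.trans ?_
  refine mul_le_mul_of_nonneg_left (Finset.prod_le_prod (fun i _ => ?_) fun i _ => ?_)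
    (Real.exp_pos _).le
  · exact Finset.sum_nonneg fun a _ => mul_nonneg ENNReal.toReal_nonneg (Real.exp_pos _).le
  · rw [flipRandomizer_marginal q (x i) j
      fun c => Real.exp (l * ((if c then 1 else 0) - flipMean q (decide (j = x i))))]
    exact flipBit_mgf_le q _ hl

/-- The choice is `l = min 1 (sqrt (L / v))`, where `sqrt (L / v)` balances `v * l ^ 2` against `L`
and the cap at 1 keeps the moment bound valid. -/
lemma exists_chernoff_parameter {v L : ℝ} (hv : 0 < v) (hL : 0 < L) :
    ∃ l : ℝ, 0 < l ∧ l ≤ 1 ∧ v * l ^ 2 - l * (L + 2 * Real.sqrt (L * v)) ≤ -L := by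
  have hsv : 0 < Real.sqrt v := Real.sqrt_pos.2 hv
  have hsL : 0 < Real.sqrt L := Real.sqrt_pos.2 hL
  have hv2 := Real.sq_sqrt hv.le
  have hL2 := Real.sq_sqrt hL.le
  rw [Real.sqrt_mul hL.le]
  rcases le_total v L with h | h
  · refine ⟨1, one_pos, le_rfl, ?_⟩
    have : Real.sqrt v ≤ Real.sqrt L := Real.sqrt_le_sqrt h
    nlinarith
  · refine ⟨Real.sqrt L / Real.sqrt v, by positivity, ?_, ?_⟩
    · rw [div_le_one hsv]; exact Real.sqrt_le_sqrt h
    · have e1 : v * (Real.sqrt L / Real.sqrt v) ^ 2 = L := by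
        rw [div_pow, hv2, hL2]; field_simp
      have e2 : Real.sqrt L / Real.sqrt v * (L + 2 * (Real.sqrt L * Real.sqrt v)) =
          Real.sqrt L / Real.sqrt v * L + 2 * L := by
        field_simp
        nlinarith
      rw [e1, e2]
      have : 0 ≤ Real.sqrt L / Real.sqrt v * L := by positivity
      linarith

/-- Bernstein's inequality for the counts, with a union bound over the bins. -/
lemma prodExp_countDev_ge {d n : ℕ} (hd : 0 < d) (hn : 0 < n) {q : unitInterval}
    (hq : 0 < (q : ℝ)) (x : Fin n → Fin d) {φ : (Fin n → Fin 1 → Fin d → Bool) → ℝ}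
    (hφ0 : ∀ y, 0 ≤ φ y)
    (hφ : ∀ y, (∀ j, |countDev q x y j| ≤
      Real.log (20 * d) + 2 * Real.sqrt (Real.log (20 * d) * (n * q))) → φ y = 1) :
    9 / 10 ≤ prodExp φ fun i a => (flipRandomizer d 0 q (x i) a).toReal := by
  have hd' : (1 : ℝ) ≤ d := by exact_mod_cast hd
  have hn' : (0 : ℝ) < n := by exact_mod_cast hn
  have hL : 0 < Real.log (20 * d) := Real.log_pos (by linarith)
  obtain ⟨l, hl0, hl1, hl⟩ := exists_chernoff_parameter (v := n * q) (by positivity) hL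
  set t := Real.log (20 * d) + 2 * Real.sqrt (Real.log (20 * d) * (n * q)) with ht
  have hR : ∀ (i : Fin n) (a : Fin 1 → Fin d → Bool),
      0 ≤ (flipRandomizer d 0 q (x i) a).toReal := fun _ _ => ENNReal.toReal_nonneg
  -- Markov's inequality and the union bound in pointwise form: one large deviation already makes
  -- the left side nonpositive.
  have hpt : ∀ y, 1 - ∑ j, (Real.exp (l * countDev q x y j - l * t) +
      Real.exp (-l * countDev q x y j - l * t)) ≤ φ y := by
    intro y
    by_cases hy : ∀ j, |countDev q x y j| ≤ t
    · rw [hφ y hy]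
      have : 0 ≤ ∑ j, (Real.exp (l * countDev q x y j - l * t) +
        Real.exp (-l * countDev q x y j - l * t)) := Finset.sum_nonneg fun j _ => by positivity
      linarith
    · push Not at hy
      obtain ⟨j, hj⟩ := hy
      refine le_trans ?_ (hφ0 y)
      have h1 := Finset.single_le_sum (f := fun j => Real.exp (l * countDev q x y j - l * t) +
        Real.exp (-l * countDev q x y j - l * t)) (fun j _ => by positivity) (Finset.mem_univ j)
      have h2 : 1 ≤ Real.exp (l * countDev q x y j - l * t) +
        Real.exp (-l * countDev q x y j - l * t) := by
        rcases lt_abs.1 hj with h | h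
        · have : 1 ≤ Real.exp (l * countDev q x y j - l * t) :=
            Real.one_le_exp (by nlinarith)
          linarith [Real.exp_pos (-l * countDev q x y j - l * t)]
        · have : 1 ≤ Real.exp (-l * countDev q x y j - l * t) :=
            Real.one_le_exp (by nlinarith)
          linarith [Real.exp_pos (l * countDev q x y j - l * t)]
      linarith
  refine le_trans ?_ (prodExp_mono hpt hR)
  have hexp : prodExp (fun y => 1 - ∑ j, (Real.exp (l * countDev q x y j - l * t) +
      Real.exp (-l * countDev q x y j - l * t)))
      (fun i a => (flipRandomizer d 0 q (x i) a).toReal) =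
      1 - ∑ j, (prodExp (fun y => Real.exp (l * countDev q x y j - l * t))
          (fun i a => (flipRandomizer d 0 q (x i) a).toReal) +
        prodExp (fun y => Real.exp (-l * countDev q x y j - l * t))
          (fun i a => (flipRandomizer d 0 q (x i) a).toReal)) := by
    have h1 := prodExp_const_mul_prod 1 (fun (_ : Fin n) (_ : Fin 1 → Fin d → Bool) => (1 : ℝ))
      (fun i a => (flipRandomizer d 0 q (x i) a).toReal)
    simp only [mul_one, Finset.prod_const_one, sum_toReal_eq_one] at h1
    simp only [prodExp_sub_sum, h1, prodExp_add]
  rw [hexp]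
  -- Two tails for each of `d` bins, at `1 / (20 * d)` each, total `1 / 10`.
  have htail : Real.exp (n * l ^ 2 * q - l * t) ≤ 1 / (20 * d) := by
    have : Real.exp (-Real.log (20 * d)) = 1 / (20 * d) := by
      rw [Real.exp_neg, Real.exp_log (by positivity), one_div]
    rw [← this]
    exact Real.exp_le_exp.2 (by linarith)
  have hsum : ∑ j : Fin d, (prodExp (fun y => Real.exp (l * countDev q x y j - l * t))
          (fun i a => (flipRandomizer d 0 q (x i) a).toReal) +
        prodExp (fun y => Real.exp (-l * countDev q x y j - l * t))
          (fun i a => (flipRandomizer d 0 q (x i) a).toReal)) ≤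
      ∑ _j : Fin d, (1 / (20 * d) + 1 / (20 * d) : ℝ) := by
    refine Finset.sum_le_sum fun j _ => add_le_add ?_ ?_
    · exact (prodExp_exp_countDev_le q x j (by rw [abs_of_pos hl0]; exact hl1) _).trans htail
    · refine (prodExp_exp_countDev_le q x j (by rw [abs_neg, abs_of_pos hl0]; exact hl1) _).trans ?_
      rw [neg_sq]; exact htail
  have h10 : ∑ _j : Fin d, (1 / (20 * d) + 1 / (20 * d) : ℝ) = 1 / 10 := by
    rw [Finset.sum_const, Finset.card_univ, Fintype.card_fin, nsmul_eq_mul]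
    field_simp
    norm_num
  linarith

/-! ### Error bound in terms of the parameters -/

/-- The estimate is unbiased: a count has mean `n * q` plus `1 - 2 * q` times the true count. -/
lemma flipAnalyzer_sub_histogram {d n : ℕ} (hn : 0 < n) {q : unitInterval}
    (hq : (q : ℝ) < 1 / 2) (x : Fin n → Fin d) (y : Fin n → Fin 1 → Fin d → Bool) (j : Fin d) :
    flipAnalyzer d n 0 q (fun p => y p.1 p.2) j - histogram x j =
      countDev q x y j / ((1 - 2 * q) * n) := by
  have hn' : (n : ℝ) ≠ 0 := by exact_mod_cast hn.ne'
  have hq' : 1 - 2 * (q : ℝ) ≠ 0 := by linarith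
  have h1 : ∑ i, flipMean q (decide (j = x i)) =
      n * q + (1 - 2 * q) * ∑ i, if x i = j then (1 : ℝ) else 0 := by
    have : ∀ i, flipMean q (decide (j = x i)) =
        q + (1 - 2 * q) * if x i = j then (1 : ℝ) else 0 := by
      intro i
      by_cases h : x i = j
      · simp [flipMean, h]; ring
      · simp [flipMean, h, Ne.symm h]
    rw [Finset.sum_congr rfl fun i _ => this i, Finset.sum_add_distrib, ← Finset.mul_sum]
    simp
  unfold flipAnalyzer histogram countDev
  rw [Finset.sum_sub_distrib, h1, Fintype.sum_prod_type]
  have h2 : ∀ i, ∑ l : Fin (0 + 1), (if y i l j then (1 : ℝ) else 0) = if y i 0 j then 1 else 0 :=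
    fun i => Fin.sum_univ_one _
  simp only [h2]
  field_simp
  push_cast
  ring

/-- The accuracy of the protocol in terms of the flipping probability. -/
lemma output_maxError {d n : ℕ} (hd : 0 < d) (hn : 0 < n) {q : unitInterval}
    (hq0 : 0 < (q : ℝ)) (hq : (q : ℝ) ≤ 1 / 3) (x : Fin n → Fin d) {B : ℝ}
    (hB : 3 * (Real.log (20 * d) + 2 * Real.sqrt (Real.log (20 * d) * (n * q))) / n ≤ B) :
    9 / 10 ≤ ((flipProtocol d n 0 q).output x).toOuterMeasure {z | maxError x z ≤ B} := by
  have hn' : (0 : ℝ) < n := by exact_mod_cast hn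
  have key : 9 / 10 ≤
      (((flipProtocol d n 0 q).output x).toOuterMeasure {z | maxError x z ≤ B}).toReal := by
    rw [output_toReal]
    refine prodExp_countDev_ge hd hn hq0 x
      (fun y => Set.indicator_nonneg (fun _ _ => zero_le_one) _) fun y hy => ?_
    refine Set.indicator_of_mem ?_ _
    have : Nonempty (Fin d) := ⟨⟨0, hd⟩⟩
    change ⨆ j, |flipAnalyzer d n 0 q (fun p => y p.1 p.2) j - histogram x j| ≤ B
    refine ciSup_le fun j => ?_
    rw [flipAnalyzer_sub_histogram hn (by linarith), abs_div,
      abs_of_pos (mul_pos (by linarith) hn')]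
    refine le_trans ?_ hB
    have h3 : 1 / 3 ≤ 1 - 2 * (q : ℝ) := by linarith
    rw [div_le_div_iff₀ (mul_pos (by linarith) hn') hn']
    have h4 := hy j
    have h5 := (abs_nonneg _).trans h4
    generalize Real.log (20 * d) + 2 * Real.sqrt (Real.log (20 * d) * (n * q)) = t at *
    calc |countDev q x y j| * n ≤ t * n := mul_le_mul_of_nonneg_right h4 hn'.le
      _ ≤ 3 * t * ((1 - 2 * q) * n) := by
        have : 0 ≤ t * n := by positivity
        nlinarith
  have h := ENNReal.ofReal_le_ofReal key
  rw [ENNReal.ofReal_toReal (toOuterMeasure_ne_top _ _)] at h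
  refine le_trans (le_of_eq ?_) h
  rw [ENNReal.ofReal_div_of_pos (by norm_num)]
  norm_num

/-- Since `20 ≤ 2 ^ 5 ≤ d ^ 5`, the factor 20 from the failure probability is absorbed. -/
lemma log_twenty_mul_le {d : ℕ} (hd : 2 ≤ d) : Real.log (20 * d) ≤ 6 * Real.log d := by
  have hd' : (2 : ℝ) ≤ d := by exact_mod_cast hd
  rw [show 6 * Real.log d = Real.log ((d : ℝ) ^ 6) by rw [Real.log_pow]; norm_num]
  refine Real.log_le_log (by positivity) ?_
  have : (2 : ℝ) ^ 5 ≤ (d : ℝ) ^ 5 := pow_le_pow_left₀ (by norm_num) hd' 5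
  nlinarith

/-- The 16 comes from `log (4 / δ) ≤ 3 * log (1 / δ)` and `80 * 3 ≤ 16 ^ 2`. The bound `ε ≤ max 1 E
* min 1 ε` is the source of the dependence on `E`. -/
lemma flipProb_le {n : ℕ} {ε δ E : ℝ} (hn0 : 0 < n) (hε : 0 < ε) (hεE : ε ≤ E) (hδ : 0 < δ)
    (hδ1 : δ ≤ 1 / 2) :
    (flipProb n ε δ : ℝ) ≤
      16 * max 1 E * Real.sqrt (Real.log (1 / δ)) / (ε * Real.sqrt n) := by
  have hn' : (0 : ℝ) < n := by exact_mod_cast hn0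
  have h2 : Real.log 2 ≤ Real.log (1 / δ) :=
    Real.log_le_log (by norm_num) (by rw [le_div_iff₀ hδ]; linarith)
  have hl2 : 0 < Real.log 2 := Real.log_pos (by norm_num)
  have hL : Real.log (4 / δ) ≤ 3 * Real.log (1 / δ) := by
    rw [show 4 / δ = 2 ^ 2 * (1 / δ) by ring, Real.log_mul (by norm_num) (by positivity),
      Real.log_pow]
    push_cast
    linarith
  have hL0 : 0 < Real.log (4 / δ) := Real.log_pos (by rw [lt_div_iff₀ hδ]; linarith)
  set L := Real.log (4 / δ)
  set L₁ := Real.log (1 / δ)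
  have hm : 0 < min 1 ε := by positivity
  have hK : ε ≤ max 1 E * min 1 ε := by
    rcases le_total 1 ε with h | h
    · rw [min_eq_left h, mul_one]; exact hεE.trans (le_max_right _ _)
    · rw [min_eq_right h]; nlinarith [le_max_left 1 E]
  rw [coe_flipProb]
  have hA : 0 < Real.sqrt ((min 1 ε) ^ 2 * n / (80 * L)) := Real.sqrt_pos.2 (by positivity)
  have h80 : Real.sqrt (80 * L) ≤ 16 * Real.sqrt L₁ := by
    rw [show (16 : ℝ) * Real.sqrt L₁ = Real.sqrt (256 * L₁) by
      rw [Real.sqrt_mul (by norm_num), show (256 : ℝ) = 16 ^ 2 by norm_num,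
        Real.sqrt_sq (by norm_num)]]
    exact Real.sqrt_le_sqrt (by linarith)
  calc _ ≤ 1 / Real.sqrt ((min 1 ε) ^ 2 * n / (80 * L)) :=
        one_div_le_one_div_of_le hA (by linarith)
    _ = Real.sqrt (80 * L) / (min 1 ε * Real.sqrt n) := by
        rw [Real.sqrt_div (by positivity), Real.sqrt_mul (by positivity), Real.sqrt_sq hm.le,
          one_div_div]
    _ ≤ 16 * Real.sqrt L₁ / (min 1 ε * Real.sqrt n) :=
        div_le_div_of_nonneg_right h80 (by positivity)
    _ ≤ _ := by
        have hsn : 0 < Real.sqrt n := Real.sqrt_pos.2 hn'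
        rw [div_le_div_iff₀ (by positivity) (by positivity)]
        have := mul_le_mul_of_nonneg_left hK
          (show 0 ≤ 16 * Real.sqrt L₁ * Real.sqrt n by positivity)
        linarith

theorem flipProtocol_accuracy {d n : ℕ} {ε δ E : ℝ} (hd : 2 ≤ d) (hε : 0 < ε) (hεE : ε ≤ E)
    (hδ : 0 < δ) (hδ1 : δ ≤ 1 / 2) (hn : 320 * Real.log (4 / δ) ≤ (min 1 ε) ^ 2 * n)
    (x : Fin n → Fin d) :
    9 / 10 ≤ ((flipProtocol d n 0 (flipProb n ε δ)).output x).toOuterMeasure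
      {z | maxError x z ≤ 60 * Real.sqrt (max 1 E) * (Real.log d / n +
        Real.sqrt (Real.log d) / (Real.sqrt ε * (n : ℝ) ^ (3 / 4 : ℝ)) *
          (Real.log (1 / δ)) ^ (1 / 4 : ℝ))} := by
  have hL0 : 0 < Real.log (4 / δ) := Real.log_pos (by rw [lt_div_iff₀ hδ]; linarith)
  have hn0 : 0 < n := by
    rcases Nat.eq_zero_or_pos n with rfl | h
    · simp at hn; linarith
    · exact h
  have hn' : (0 : ℝ) < n := by exact_mod_cast hn0
  have hd' : (2 : ℝ) ≤ d := by exact_mod_cast hd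
  have hq := flipProb_le hn0 hε hεE hδ hδ1
  have hK : 1 ≤ max 1 E := le_max_left _ _
  have hsK : 1 ≤ Real.sqrt (max 1 E) := Real.one_le_sqrt.2 hK
  have hL1 : 0 ≤ Real.log (1 / δ) := Real.log_nonneg (by rw [le_div_iff₀ hδ]; linarith)
  have hD : 0 < Real.log d := Real.log_pos (by linarith)
  -- As `320 = 4 * 80`, the square root is at least 2, so `q ≤ 1 / 3` and the debiasing factor `1 /
  -- (1 - 2 * q)` is at most 3.
  have hA : 2 ≤ Real.sqrt ((min 1 ε) ^ 2 * n / (80 * Real.log (4 / δ))) := by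
    refine Real.le_sqrt_of_sq_le ?_
    rw [le_div_iff₀ (by positivity)]
    linarith
  have hq0 : 0 < (flipProb n ε δ : ℝ) := by rw [coe_flipProb]; positivity
  have hq3 : (flipProb n ε δ : ℝ) ≤ 1 / 3 := by
    rw [coe_flipProb]
    exact one_div_le_one_div_of_le (by norm_num) (by linarith)
  refine output_maxError (by omega) hn0 hq0 hq3 x ?_
  have hl := log_twenty_mul_le hd
  have hl0 : 0 ≤ Real.log (20 * d) := Real.log_nonneg (by linarith)
  set l := Real.log (20 * d)
  set D := Real.log d
  set L₁ := Real.log (1 / δ)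
  set q := (flipProb n ε δ : ℝ)
  set K := max 1 E
  set B := Real.sqrt D / (Real.sqrt ε * (n : ℝ) ^ (3 / 4 : ℝ)) * L₁ ^ (1 / 4 : ℝ) with hB
  have hB0 : 0 ≤ B := by positivity
  have hB2 : B ^ 2 = D * Real.sqrt L₁ / (ε * (n * Real.sqrt n)) := by
    have e1 : ((n : ℝ) ^ (3 / 4 : ℝ)) ^ 2 = n * Real.sqrt n := by
      rw [Real.sqrt_eq_rpow, ← Real.rpow_natCast, ← Real.rpow_mul hn'.le]
      nth_rewrite 2 [← Real.rpow_one (n : ℝ)]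
      rw [← Real.rpow_add hn']
      norm_num
    have e2 : (L₁ ^ (1 / 4 : ℝ)) ^ 2 = Real.sqrt L₁ := by
      rw [Real.sqrt_eq_rpow, ← Real.rpow_natCast, ← Real.rpow_mul hL1]
      norm_num
    rw [hB, mul_pow, div_pow, mul_pow, e1, e2, Real.sq_sqrt hD.le, Real.sq_sqrt hε.le]
    ring
  -- Squares are compared: `6 * 16 = 96 ≤ 10 ^ 2`. The prefactor `3 * 2` of this term then gives the
  -- constant 60.
  have hmain : Real.sqrt (l * (n * q)) / n ≤ 10 * Real.sqrt K * B := by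
    refine abs_le_of_sq_le_sq' ?_ (by positivity) |>.2
    rw [div_pow, Real.sq_sqrt (by positivity), mul_pow, mul_pow, Real.sq_sqrt (by linarith), hB2]
    have hsn : 0 < Real.sqrt n := Real.sqrt_pos.2 hn'
    calc l * (n * q) / n ^ 2 = l * q / n := by field_simp
      _ ≤ 6 * D * (16 * K * Real.sqrt L₁ / (ε * Real.sqrt n)) / n :=
          div_le_div_of_nonneg_right (mul_le_mul hl hq hq0.le (by positivity)) hn'.le
      _ = 96 * (K * (D * Real.sqrt L₁ / (ε * (n * Real.sqrt n)))) := by field_simp; ring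
      _ ≤ 100 * (K * (D * Real.sqrt L₁ / (ε * (n * Real.sqrt n)))) := by
          have : 0 ≤ K * (D * Real.sqrt L₁ / (ε * (n * Real.sqrt n))) := by positivity
          linarith
      _ = _ := by ring
  have hfirst : 3 * (l / n) ≤ 60 * Real.sqrt K * (D / n) := by
    have h1 : l / n ≤ 6 * (D / n) := by
      rw [← mul_div_assoc]; exact div_le_div_of_nonneg_right hl hn'.le
    have h2 : 0 ≤ D / n := by positivity
    nlinarith
  have e : 3 * (l + 2 * Real.sqrt (l * (n * q))) / n =
      3 * (l / n) + 6 * (Real.sqrt (l * (n * q)) / n) := by ring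
  rw [e]
  linarith

end ShuffleHistogram
end

open ShuffleHistogram in
theorem mainTheorem2 :
    -- privacy
    (∀ (d n : ℕ) (ε δ : ℝ), 0 < ε → 0 < δ → δ < 1 →
      80 * Real.log (4 / δ) ≤ (min 1 ε) ^ 2 * n →
      (flipProtocol d n 0 (flipProb n ε δ)).IsShufflePrivate ε δ) ∧
    -- accuracy, with an implied constant that depends only on the upper bound for `ε`
    (∀ E : ℝ, 0 < E → ∃ C : ℝ, 0 < C ∧
      ∀ (d n : ℕ) (ε δ : ℝ), 2 ≤ d → 0 < ε → ε ≤ E → 0 < δ → δ ≤ 1 / 2 →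
        320 * Real.log (4 / δ) ≤ (min 1 ε) ^ 2 * n →
        ∀ x : Fin n → Fin d,
          9 / 10 ≤ ((flipProtocol d n 0 (flipProb n ε δ)).output x).toOuterMeasure
            {z | maxError x z ≤ C * (Real.log d / n +
              Real.sqrt (Real.log d) / (Real.sqrt ε * (n : ℝ) ^ (3 / 4 : ℝ)) *
                (Real.log (1 / δ)) ^ (1 / 4 : ℝ))}) := by
  refine ⟨fun d n ε δ hε hδ hδ1 hn => flipProtocol_isShufflePrivate d n hε hδ hδ1 hn,
    fun E hE => ⟨60 * Real.sqrt (max 1 E), by positivity, ?_⟩⟩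
  intro d n ε δ hd hε hεE hδ hδ1 hn x
  exact flipProtocol_accuracy hd hε hεE hδ hδ1 hn x
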